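/- Let $N\ge 1$. A ribbon graph (map) with $e\ge 1$ edges is a triple $(H,\alpha,\sigma)$ with $H=\{1,\dots,2e\}$ and permutations $\alpha,\sigma$ of $H$ such that $\alpha$ is a fixed-point-free involution and $\langle\alpha,\sigma\rangle$ acts transitively on $H$. An $N$-rooted map is a ribbon graph together with ordered elements $\hat h_1,\dots,\hat h_N\in H$ lying in $N$ distinct cycles of $\sigma$. An isomorphism $(H,\alpha,\sigma,\hat h)\to(H,\alpha',\sigma',\hat h')$ is a permutation $\psi$ of $H$ with $\alpha'\psi=\psi\alpha$, $\sigma'\psi=\psi\sigma$ and $\psi(\hat h_i)=\hat h_i'$ for all $i$. For $e\ge1$ let $m_N(e)$ be the number of isomorphism classes of $N$-rooted maps with $e$ edges; the one-point map without edges counts as a single $1$-rooted map, so $m_1(0)=1$ and $m_N(0)=0$ for $N\ge2$. Let $M_N(\lambda)=\sum_{e\ge0}m_N(e)\lambda^{2e}$, a formal power series, and for $j\ge 0$ let $$\mathcal Z_j=\sum_{k=0}^\infty\frac{(2k+j)!\,(2k-1)!!}{(2k)!}\,\lambda^{2k}\qquad\text{(with }(-1)!!=1).$$ Then, as formal power series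 in $\lambda$, $$M_N(\lambda)=\sum_{\substack{\alpha_1+2\alpha_2+\cdots+N\alpha_N=N\\ \alpha_1,\dots,\alpha_N\ge0}}\frac{N!}{\alpha_1!\cdots\alpha_N!}\;\frac{(-1)^{\alpha_1+\cdots+\alpha_N-1}(\alpha_1+\cdots+\alpha_N-1)!}{\mathcal Z_0^{\alpha_1+\cdots+\alpha_N}}\;\prod_{j=1}^N\Bigl(\frac{\mathcal Z_j}{(j!)^2}\Bigr)^{\alpha_j}.$$ Consequently, for every $e\ge0$, $m_N(e)$ is the coefficient of $\lambda^{2e}$ in the right-hand side, that is, $$m_N(e)=\frac1{(2e)!}\,\frac{d^{2e}}{d\lambda^{2e}}M_N(\lambda)\Big|_{\lambda=0},$$ with formal derivatives and evaluation at $\lambda=0$ meaning the constant term. -/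

import Mathlib

open scoped Nat PowerSeries

/-- A ribbon graph (a map) with `e` edges, on the set `Fin (2 * e)` of half-edges. -/
structure RibbonGraph (e : ℕ) where
  /-- the permutation whose cycles are the edges -/
  α : Equiv.Perm (Fin (2 * e))
  /-- the permutation whose cycles are the vertices -/
  σ : Equiv.Perm (Fin (2 * e))
  involutive : Function.Involutive α
  fixedPointFree : ∀ h, α h ≠ h
  transitive : MulAction.IsPretransitive (Subgroup.closure {α, σ}) (Fin (2 * e))

/-- An `N`-rooted ribbon graph with `e` edges: `N` ordered half-edges are chosen that lie on
pairwise different cycles of `σ` (a fixed point of `σ` is a cycle of length one). -/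
structure NRootedGraph (N e : ℕ) extends RibbonGraph e where
  root : Fin N → Fin (2 * e)
  root_distinct : ∀ i j, i ≠ j → ¬ σ.SameCycle (root i) (root j)

namespace NRootedGraph

/-- `N`-rooted isomorphism: a bijection of the half-edges that intertwines both permutations and
maps the `i`-th root to the `i`-th root. -/
def Iso {N e : ℕ} (Γ Γ' : NRootedGraph N e) : Prop :=
  ∃ ψ : Equiv.Perm (Fin (2 * e)),
    Γ'.α * ψ = ψ * Γ.α ∧ Γ'.σ * ψ = ψ * Γ.σ ∧ ∀ i, ψ (Γ.root i) = Γ'.root i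

theorem Iso.refl {N e : ℕ} (Γ : NRootedGraph N e) : Iso Γ Γ :=
  ⟨1, by simp, by simp, by simp⟩

theorem Iso.symm {N e : ℕ} {Γ Γ' : NRootedGraph N e} (h : Iso Γ Γ') : Iso Γ' Γ := by
  obtain ⟨ψ, ha, hs, hr⟩ := h
  refine ⟨ψ⁻¹, ?_, ?_, fun i => ?_⟩
  · rw [eq_inv_mul_iff_mul_eq, ← mul_assoc, ← ha, mul_assoc, mul_inv_cancel, mul_one]
  · rw [eq_inv_mul_iff_mul_eq, ← mul_assoc, ← hs, mul_assoc, mul_inv_cancel, mul_one]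
  · rw [← hr i]; exact ψ.symm_apply_apply _

theorem Iso.trans {N e : ℕ} {Γ₁ Γ₂ Γ₃ : NRootedGraph N e} (h : Iso Γ₁ Γ₂) (h' : Iso Γ₂ Γ₃) :
    Iso Γ₁ Γ₃ := by
  obtain ⟨ψ, ha, hs, hr⟩ := h
  obtain ⟨χ, ha', hs', hr'⟩ := h'
  refine ⟨χ * ψ, ?_, ?_, fun i => ?_⟩
  · rw [← mul_assoc, ha', mul_assoc, ha, mul_assoc]
  · rw [← mul_assoc, hs', mul_assoc, hs, mul_assoc]
  · rw [Equiv.Perm.mul_apply, hr, hr']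

instance setoid (N e : ℕ) : Setoid (NRootedGraph N e) where
  r := Iso
  iseqv := ⟨Iso.refl, Iso.symm, Iso.trans⟩

end NRootedGraph

/-- `m_N(e)`: the number of `N`-rooted maps with `e` edges, up to `N`-rooted isomorphism.
The only map without edges is the one-vertex map without half-edges; it counts as a one-rooted
map, and it has too few vertices to be `N`-rooted for `N ≥ 2`. -/
noncomputable def numNRootedMaps (N e : ℕ) : ℕ :=
  if e = 0 then (if N = 1 then 1 else 0)
  else Nat.card (Quotient (NRootedGraph.setoid N e))

/-- `M_N(λ) = ∑ₑ m_N(e) λ^(2e)`, a formal power series in `λ`. -/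
noncomputable def genNRootedMaps (N : ℕ) : ℚ⟦X⟧ :=
  PowerSeries.mk fun n => if Even n then (numNRootedMaps N (n / 2) : ℚ) else 0

/-- `𝒵_j(λ) = ∑ₖ (2k+j)! (2k-1)‼ / (2k)! λ^(2k)`, a formal power series in `λ`.
The double factorial `(-1)‼ = 1` at `k = 0` is `(2 * 0 - 1)‼ = 0‼ = 1` here. -/
noncomputable def genZ (j : ℕ) : ℚ⟦X⟧ :=
  PowerSeries.mk fun n =>
    if Even n then (((n + j)! : ℚ) * ((n - 1)‼ : ℚ)) / (n ! : ℚ) else 0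

/-- The tuples `(α₁, …, α_N)` of natural numbers with `α₁ + 2 α₂ + … + N α_N = N`;
`a j` stands for `α_(j+1)`. The bound `a j ≤ N` is automatic, see `mem_partitionTuples`. -/
def partitionTuples (N : ℕ) : Finset (Fin N → ℕ) :=
  (Fintype.piFinset fun _ : Fin N => Finset.range (N + 1)).filter
    fun a => ∑ j : Fin N, ((j : ℕ) + 1) * a j = N

theorem mem_partitionTuples {N : ℕ} (a : Fin N → ℕ) :
    a ∈ partitionTuples N ↔ ∑ j : Fin N, ((j : ℕ) + 1) * a j = N := by
  simp only [partitionTuples, Finset.mem_filter, Fintype.mem_piFinset, Finset.mem_range,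
    and_iff_right_iff_imp]
  intro h j
  have h1 : ((j : ℕ) + 1) * a j ≤ ∑ i : Fin N, ((i : ℕ) + 1) * a i :=
    Finset.single_le_sum (f := fun i : Fin N => ((i : ℕ) + 1) * a i)
      (fun _ _ => Nat.zero_le _) (Finset.mem_univ j)
  nlinarith [Nat.zero_le ((j : ℕ) * a j)]

/-- The sum over all `α₁ + 2 α₂ + … + N α_N = N` of
`N! / ∏ α_j! * (-1)^(s-1) (s-1)! / 𝒵₀^s * ∏ (𝒵_j / (j!)²)^(α_j)`, with `s = ∑ α_j`.
The inverse is that of formal power series (the constant term of `𝒵₀` is `1`),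
and `s ≥ 1` as soon as `N ≥ 1`. -/
noncomputable def closedForm (N : ℕ) : ℚ⟦X⟧ :=
  ∑ a ∈ partitionTuples N,
    (((N ! : ℚ) / ∏ j : Fin N, ((a j)! : ℚ)) *
        ((-1) ^ ((∑ j : Fin N, a j) - 1) * (((∑ j : Fin N, a j) - 1)! : ℚ))) •
      ((genZ 0 ^ (∑ j : Fin N, a j))⁻¹ *
        ∏ j : Fin N, (((((j : ℕ) + 1)! : ℚ) ^ 2)⁻¹ • genZ ((j : ℕ) + 1)) ^ a j)

/-!
A root is encoded by a leg, inserted into the cycle of its vertex just before the rooted half-edge;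
an isolated vertex can then be rooted as well. Without connectedness, the edges and the vertices are
chosen independently: on `n` labelled half-edges and `N` labelled legs there are
`(n - 1)‼ * (n + N)! / N!` structures if `n` is even, and none if `n` is odd. Let `F` be the
exponential generating function of all structures, in two variables, and `L` that of the connected
ones. Splitting off the component of a distinguished leg gives `F' = L' * F`, where the derivative
is with respect to the variable that counts the legs, so that up to terms without legs `L` is the
logarithm of `F / 𝒵₀`. Its expansion by the multinomial theorem is the sum over partitions of `N`.
Finally, an automorphism of a connected map that fixes a root is trivial, so each `N`-rooted map
with `e` edges has exactly `(2 * e)!` labellings.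
-/

section Logarithm

open PowerSeries Finset

variable {R : Type*} [CommRing R]

theorem X_pow_succ_dvd_sub_sum_C_mul_X_pow {u : R⟦X⟧} (hu : constantCoeff u = 0) (N : ℕ) :
    X ^ (N + 1) ∣ u - ∑ j : Fin N, C (coeff (j + 1) u) * X ^ ((j : ℕ) + 1) := by
  rw [X_pow_dvd_iff]
  intro m hm
  rw [map_sub, map_sum,
    Fin.sum_univ_eq_sum_range (fun j => coeff m (C (coeff (j + 1) u) * X ^ (j + 1)))]
  rcases m with _ | m
  · simp [hu]
  · simp [coeff_X_pow, show m < N by lia]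

theorem coeff_pow_eq_sum_piAntidiag {u : R⟦X⟧} (hu : constantCoeff u = 0) (N s : ℕ) :
    coeff N (u ^ s) =
      ∑ a ∈ piAntidiag (univ : Finset (Fin N)) s with ∑ j : Fin N, ((j : ℕ) + 1) * a j = N,
        (Nat.multinomial univ a : R) * ∏ j : Fin N, coeff (j + 1) u ^ a j := by
  have htrunc : coeff N (u ^ s) =
      coeff N ((∑ j : Fin N, C (coeff (j + 1) u) * X ^ ((j : ℕ) + 1)) ^ s) := by
    have hdvd := (X_pow_succ_dvd_sub_sum_C_mul_X_pow hu N).trans (sub_dvd_pow_sub_pow _ _ s)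
    simpa only [map_sub, sub_eq_zero] using X_pow_dvd_iff.1 hdvd N N.lt_succ_self
  rw [htrunc, sum_pow_eq_sum_piAntidiag, map_sum, sum_filter]
  refine sum_congr rfl fun a _ => ?_
  have hmonomial : ∏ j : Fin N, (C (coeff (j + 1) u) * X ^ ((j : ℕ) + 1)) ^ a j =
      C (∏ j : Fin N, coeff (j + 1) u ^ a j) * X ^ (∑ j : Fin N, ((j : ℕ) + 1) * a j) := by
    simp only [mul_pow, prod_mul_distrib, ← pow_mul, prod_pow_eq_pow_sum, map_prod, map_pow]
  rw [hmonomial, ← map_natCast (C (R := R)), coeff_C_mul, coeff_C_mul, coeff_X_pow]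
  simp only [eq_comm (a := N), mul_ite, mul_one, mul_zero]

theorem sum_mem_Icc_of_mem_partitionTuples {N : ℕ} (hN : N ≠ 0) {a : Fin N → ℕ}
    (ha : a ∈ partitionTuples N) : ∑ j, a j ∈ Icc 1 N := by
  rw [mem_partitionTuples] at ha
  refine mem_Icc.2 ⟨Nat.one_le_iff_ne_zero.2 fun h => hN ?_, ?_⟩
  · rw [← ha]
    exact sum_eq_zero fun j hj => by rw [sum_eq_zero_iff.1 h j hj, mul_zero]
  · calc ∑ j, a j ≤ ∑ j : Fin N, ((j : ℕ) + 1) * a j :=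
          sum_le_sum fun j _ => Nat.le_mul_of_pos_left _ j.val.succ_pos
      _ = N := ha

theorem filter_partitionTuples_sum_eq (N s : ℕ) :
    {a ∈ partitionTuples N | ∑ j, a j = s} =
      {a ∈ piAntidiag (univ : Finset (Fin N)) s | ∑ j : Fin N, ((j : ℕ) + 1) * a j = N} := by
  ext a
  simp [mem_partitionTuples, and_comm]

theorem derivative_C_mul (c : R) (f : R⟦X⟧) : d⁄dX R (C c * f) = C c * d⁄dX R f := by
  ext n
  simp only [coeff_derivative, coeff_C_mul, mul_assoc]

variable [Algebra ℚ R]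

variable (R) in
theorem one_add_X_mul_derivative_log : (1 + X) * d⁄dX R (log R) = 1 := by
  ext (_ | n)
  · simp [deriv_log, add_mul]
  · simp [deriv_log, add_mul, coeff_succ_X_mul, coeff_one, pow_succ]

theorem mul_derivative_logOf {f : R⟦X⟧} (hf : constantCoeff f = 1) :
    f * d⁄dX R (logOf f) = d⁄dX R f := by
  have hsubst : HasSubst (f - 1) := HasSubst.of_constantCoeff_zero' (by simp [hf])
  have hinv : f * (d⁄dX R (log R)).subst (f - 1) = 1 := by
    simpa only [map_mul, map_add, map_one, coe_substAlgHom, subst_X hsubst, add_sub_cancel] using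
      congrArg (substAlgHom hsubst) (one_add_X_mul_derivative_log R)
  rw [logOf_eq, derivative_subst hsubst, ← mul_assoc, hinv, one_mul, map_sub]
  simp

theorem coeff_eq_coeff_logOf {f l : R⟦X⟧} (hf : constantCoeff f = 1)
    (h : f * d⁄dX R l = d⁄dX R f) {N : ℕ} (hN : N ≠ 0) : coeff N l = coeff N (logOf f) := by
  obtain ⟨n, rfl⟩ := Nat.exists_eq_succ_of_ne_zero hN
  have hunit : IsUnit f := by rw [isUnit_iff_constantCoeff, hf]; exact isUnit_one
  have hderiv : d⁄dX R l = d⁄dX R (logOf f) :=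
    hunit.mul_left_cancel (h.trans (mul_derivative_logOf hf).symm)
  have hn : IsUnit (n + 1 : R) := by
    simpa using (IsUnit.mk0 (n + 1 : ℚ) (by positivity)).map (algebraMap ℚ R)
  simpa only [coeff_derivative, hn.mul_left_inj] using congrArg (coeff n) hderiv

theorem coeff_logOf {f : R⟦X⟧} (hf : constantCoeff f = 1) (N : ℕ) :
    coeff N (logOf f) = ∑ s ∈ Icc 1 N, ((-1) ^ (s - 1) / s : ℚ) • coeff N ((f - 1) ^ s) := by
  have hconst : constantCoeff (f - 1) = 0 := by simp [hf]
  rw [logOf_eq, coeff_subst' (HasSubst.of_constantCoeff_zero' hconst),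
    finsum_eq_sum_of_support_subset (s := Icc 1 N)]
  · refine sum_congr rfl fun s hs => ?_
    obtain ⟨s, rfl⟩ := Nat.exists_eq_succ_of_ne_zero (Nat.one_le_iff_ne_zero.1 (mem_Icc.1 hs).1)
    simp [coeff_log, pow_succ, Algebra.smul_def]
  · intro s hs
    contrapose! hs
    rw [Function.notMem_support]
    rcases Nat.eq_zero_or_pos s with rfl | hpos
    · simp
    · have hlt : N < s := by simpa [Nat.succ_le_iff.2 hpos] using hs
      rw [X_pow_dvd_iff.1 (pow_dvd_pow_of_dvd (X_dvd_iff.2 hconst) s) N hlt, smul_zero]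

theorem coeff_logOf_eq_sum_partitionTuples {f : R⟦X⟧} (hf : constantCoeff f = 1) {N : ℕ}
    (hN : N ≠ 0) :
    coeff N (logOf f) = ∑ a ∈ partitionTuples N,
      (((-1) ^ ((∑ j, a j) - 1) * (((∑ j, a j) - 1)! : ℚ)) / ∏ j, ((a j)! : ℚ)) •
        ∏ j : Fin N, coeff (j + 1) f ^ a j := by
  have hcoeff (j : ℕ) : coeff (j + 1) (f - 1) = coeff (j + 1) f := by simp [coeff_one]
  rw [coeff_logOf hf,
    ← sum_fiberwise_of_maps_to fun a ha => sum_mem_Icc_of_mem_partitionTuples hN ha]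
  refine sum_congr rfl fun s hs => ?_
  rw [filter_partitionTuples_sum_eq, coeff_pow_eq_sum_piAntidiag (by simp [hf]), smul_sum]
  refine sum_congr rfl fun a ha => ?_
  have hsum : ∑ j, a j = s := (mem_piAntidiag.1 (mem_filter.1 ha).1).1
  have hs0 : s ≠ 0 := Nat.one_le_iff_ne_zero.1 (mem_Icc.1 hs).1
  have hmultinomial : (∏ j, ((a j)! : ℚ)) * (Nat.multinomial univ a : ℚ) = s * ((s - 1)! : ℚ) := by
    have := Nat.multinomial_spec univ a
    rw [hsum, ← Nat.mul_factorial_pred hs0] at this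
    exact_mod_cast this
  have hprod : (∏ j, ((a j)! : ℚ)) ≠ 0 := prod_ne_zero_iff.2 fun j _ => by positivity
  simp only [hsum, hcoeff, ← nsmul_eq_mul, ← Nat.cast_smul_eq_nsmul ℚ, smul_smul]
  congr 1
  field_simp
  linear_combination hmultinomial

end Logarithm

open Equiv Finset Function

section Orbits

variable {V W : Type*} {f g : Perm V}

theorem orbitRel_closure_le {S : Set (Perm V)} {s : Setoid V} (h : ∀ p ∈ S, ∀ x, s x (p x)) :
    MulAction.orbitRel (Subgroup.closure S) V ≤ s := by
  rintro _ x ⟨⟨p, hp⟩, rfl⟩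
  change s (p x) x
  refine s.symm ?_
  induction hp using Subgroup.closure_induction generalizing x with
  | mem p hp => exact h p hp x
  | one => exact s.refl x
  | mul p q _ _ hp hq => exact s.trans (@hq x) (@hp (q x))
  | inv p _ hp => exact s.symm (by simpa using @hp (p⁻¹ x))

theorem sameCycle_setoid_le {s : Setoid V} (h : ∀ x, s x (f x)) :
    Perm.SameCycle.setoid f ≤ s := by
  rintro x _ ⟨i, rfl⟩
  have hle := orbitRel_closure_le (S := {f}) (s := s) fun p hp => hp ▸ h
  exact s.symm (hle ⟨⟨f ^ i, Subgroup.mem_closure_singleton.2 ⟨i, rfl⟩⟩, rfl⟩)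

theorem sameCycle_map {g : Perm W} (m : V → W) (h : ∀ x, g.SameCycle (m x) (m (f x))) {x y : V} :
    f.SameCycle x y → g.SameCycle (m x) (m y) :=
  @sameCycle_setoid_le _ _ ((Perm.SameCycle.setoid g).comap m) h x y

/-- The partition of `V` into the orbits of the group generated by `f` and `g`. -/
def linked (f g : Perm V) : Setoid V :=
  MulAction.orbitRel (Subgroup.closure {f, g}) V

theorem linked_apply_left (f g : Perm V) (x : V) : linked f g x (f x) :=
  Setoid.symm' _ ⟨⟨f, Subgroup.subset_closure (Set.mem_insert f {g})⟩, rfl⟩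

theorem linked_apply_right (f g : Perm V) (x : V) : linked f g x (g x) :=
  Setoid.symm' _ ⟨⟨g, Subgroup.subset_closure (Set.mem_insert_of_mem f rfl)⟩, rfl⟩

theorem linked_le_iff {s : Setoid V} :
    linked f g ≤ s ↔ (∀ x, s x (f x)) ∧ ∀ x, s x (g x) := by
  refine ⟨fun h => ⟨fun x => h (linked_apply_left f g x), fun x => h (linked_apply_right f g x)⟩,
    fun h => orbitRel_closure_le ?_⟩
  rintro p (rfl | rfl)
  exacts [h.1, h.2]

theorem linked_eq_top_iff_isPretransitive :
    linked f g = ⊤ ↔ MulAction.IsPretransitive (Subgroup.closure {f, g}) V := by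
  rw [MulAction.isPretransitive_iff, Setoid.eq_top_iff]
  exact forall_comm

/-- The partition of a disjoint union induced by partitions of its two parts. -/
def sumSetoid (s : Setoid V) (t : Setoid W) : Setoid (V ⊕ W) where
  r := Sum.LiftRel s t
  iseqv :=
    { refl := Sum.rec (fun x => .inl (s.refl x)) fun y => .inr (t.refl y)
      symm := by rintro _ _ (h | h); exacts [.inl (s.symm h), .inr (t.symm h)]
      trans := by
        rintro _ _ _ (h | h) (h' | h')
        exacts [.inl (s.trans h h'), .inr (t.trans h h')] }

theorem linked_sumCongr (f g : Perm V) (f' g' : Perm W) :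
    linked (sumCongr f f') (sumCongr g g') = sumSetoid (linked f g) (linked f' g') := by
  refine le_antisymm (linked_le_iff.2 ⟨?_, ?_⟩) ?_
  · rintro (x | x)
    exacts [.inl (linked_apply_left f g x), .inr (linked_apply_left f' g' x)]
  · rintro (x | x)
    exacts [.inl (linked_apply_right f g x), .inr (linked_apply_right f' g' x)]
  · have hinl : linked f g ≤ (linked (sumCongr f f') (sumCongr g g')).comap Sum.inl :=
      linked_le_iff.2 ⟨fun x => linked_apply_left _ _ (Sum.inl x),
        fun x => linked_apply_right _ _ (Sum.inl x)⟩
    have hinr : linked f' g' ≤ (linked (sumCongr f f') (sumCongr g g')).comap Sum.inr :=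
      linked_le_iff.2 ⟨fun x => linked_apply_left _ _ (Sum.inr x),
        fun x => linked_apply_right _ _ (Sum.inr x)⟩
    rintro _ _ (h | h)
    exacts [hinl h, hinr h]

theorem linked_permCongr (e : V ≃ W) (f g : Perm V) :
    linked (e.permCongr f) (e.permCongr g) = (linked f g).comap e.symm := by
  refine le_antisymm (linked_le_iff.2 ⟨fun x => ?_, fun x => ?_⟩) fun x y h => ?_
  · simpa [Setoid.comap_rel] using linked_apply_left f g (e.symm x)
  · simpa [Setoid.comap_rel] using linked_apply_right f g (e.symm x)
  · have hle : linked f g ≤ (linked (e.permCongr f) (e.permCongr g)).comap e := by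
      refine linked_le_iff.2 ⟨fun x => ?_, fun x => ?_⟩
      · simpa [Setoid.comap_rel] using linked_apply_left (e.permCongr f) (e.permCongr g) (e x)
      · simpa [Setoid.comap_rel] using linked_apply_right (e.permCongr f) (e.permCongr g) (e x)
    simpa [Setoid.comap_rel] using hle h

theorem sameCycle_sumCongr_iff (f : Perm V) (g : Perm W) {x y : V ⊕ W} :
    Perm.SameCycle (sumCongr f g) x y ↔ Sum.LiftRel f.SameCycle g.SameCycle x y := by
  constructor
  · refine @sameCycle_setoid_le _ _
      (sumSetoid (Perm.SameCycle.setoid f) (Perm.SameCycle.setoid g)) ?_ x y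
    rintro (x | x)
    exacts [.inl ⟨1, rfl⟩, .inr ⟨1, rfl⟩]
  · rintro (h | h)
    exacts [sameCycle_map Sum.inl (fun x => ⟨1, rfl⟩) h,
      sameCycle_map Sum.inr (fun x => ⟨1, rfl⟩) h]

theorem sameCycle_permCongr_iff (e : V ≃ W) (f : Perm V) {x y : W} :
    (e.permCongr f).SameCycle x y ↔ f.SameCycle (e.symm x) (e.symm y) := by
  refine ⟨sameCycle_map e.symm fun x => ⟨1, by simp⟩, fun h => ?_⟩
  simpa using sameCycle_map (g := e.permCongr f) e (fun x => ⟨1, by simp⟩) h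

end Orbits

/-- A not necessarily connected ribbon graph with set of half-edges `A` and set of legs `B`. A leg
belongs to no edge, and a vertex carries at most one leg. The leg marks a root: the rooted half-edge
is the one that follows it in the cyclic order, and there is none at an isolated vertex. -/
@[ext]
structure LeggedRibbonGraph (A B : Type*) where
  edge : Perm A
  vertex : Perm (A ⊕ B)
  edge_involutive : Involutive edge
  edge_ne : ∀ a, edge a ≠ a
  eq_of_sameCycle : ∀ b b', vertex.SameCycle (.inr b) (.inr b') → b = b'

namespace LeggedRibbonGraph

variable {A B A' B' A₁ B₁ A₂ B₂ : Type*}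

instance [Finite A] [Finite B] : Finite (LeggedRibbonGraph A B) :=
  .of_injective (fun Γ => (Γ.edge, Γ.vertex)) fun _ _ h =>
    LeggedRibbonGraph.ext (Prod.mk.inj h).1 (Prod.mk.inj h).2

/-- The partition of the half-edges and legs into the connected components. -/
def component (Γ : LeggedRibbonGraph A B) : Setoid (A ⊕ B) :=
  linked (sumCongr Γ.edge 1) Γ.vertex

/-- A ribbon graph is connected if it has at most one component. -/
def IsConnected (Γ : LeggedRibbonGraph A B) : Prop :=
  Γ.component = ⊤

/-- The transport of a ribbon graph along bijections of the half-edges and the legs. -/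
def relabel (e : A ≃ A') (e' : B ≃ B') (Γ : LeggedRibbonGraph A B) : LeggedRibbonGraph A' B' where
  edge := e.permCongr Γ.edge
  vertex := (sumCongr e e').permCongr Γ.vertex
  edge_involutive a := by simp [Γ.edge_involutive _]
  edge_ne a := by simpa [← e.eq_symm_apply] using Γ.edge_ne (e.symm a)
  eq_of_sameCycle b b' h :=
    e'.symm.injective (Γ.eq_of_sameCycle _ _ ((sameCycle_permCongr_iff _ _).1 h))

/-- `relabel` as a bijection. -/
def relabelEquiv (e : A ≃ A') (e' : B ≃ B') :
    LeggedRibbonGraph A B ≃ LeggedRibbonGraph A' B' where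
  toFun := relabel e e'
  invFun := relabel e.symm e'.symm
  left_inv Γ := by ext <;> simp [relabel]
  right_inv Γ := by ext <;> simp [relabel]

theorem component_relabel (e : A ≃ A') (e' : B ≃ B') (Γ : LeggedRibbonGraph A B) :
    (Γ.relabel e e').component = Γ.component.comap (sumCongr e e').symm := by
  have hedge : sumCongr (e.permCongr Γ.edge) 1 = (sumCongr e e').permCongr (sumCongr Γ.edge 1) := by
    ext (x | x) <;> simp
  rw [component, relabel, hedge, linked_permCongr, component]

theorem isConnected_relabel_iff (e : A ≃ A') (e' : B ≃ B') (Γ : LeggedRibbonGraph A B) :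
    (Γ.relabel e e').IsConnected ↔ Γ.IsConnected := by
  simp only [IsConnected, component_relabel, Setoid.eq_top_iff, Setoid.comap_rel,
    (sumCongr e e').symm.forall_congr_left, symm_symm, symm_apply_apply]

/-- The disjoint union of two ribbon graphs. -/
def sum (Γ₁ : LeggedRibbonGraph A₁ B₁) (Γ₂ : LeggedRibbonGraph A₂ B₂) :
    LeggedRibbonGraph (A₁ ⊕ A₂) (B₁ ⊕ B₂) where
  edge := sumCongr Γ₁.edge Γ₂.edge
  vertex := (sumSumSumComm A₁ B₁ A₂ B₂).permCongr (sumCongr Γ₁.vertex Γ₂.vertex)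
  edge_involutive := by
    rintro (a | a)
    exacts [congrArg Sum.inl (Γ₁.edge_involutive a), congrArg Sum.inr (Γ₂.edge_involutive a)]
  edge_ne := by
    rintro (a | a)
    exacts [Sum.inl_injective.ne (Γ₁.edge_ne a), Sum.inr_injective.ne (Γ₂.edge_ne a)]
  eq_of_sameCycle b b' h := by
    rw [sameCycle_permCongr_iff, sameCycle_sumCongr_iff] at h
    rcases b with b | b <;> rcases b' with b' | b' <;> rcases h with h | h
    exacts [congrArg Sum.inl (Γ₁.eq_of_sameCycle b b' h),
      congrArg Sum.inr (Γ₂.eq_of_sameCycle b b' h)]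

theorem component_sum (Γ₁ : LeggedRibbonGraph A₁ B₁) (Γ₂ : LeggedRibbonGraph A₂ B₂) :
    (Γ₁.sum Γ₂).component =
      (sumSetoid Γ₁.component Γ₂.component).comap (sumSumSumComm A₁ B₁ A₂ B₂).symm := by
  have hedge : sumCongr (sumCongr Γ₁.edge Γ₂.edge) (1 : Perm (B₁ ⊕ B₂)) =
      (sumSumSumComm A₁ B₁ A₂ B₂).permCongr
        (sumCongr (sumCongr Γ₁.edge 1) (sumCongr Γ₂.edge 1)) := by
    ext ((x | x) | (x | x)) <;> rfl
  rw [component, sum, hedge, linked_permCongr, linked_sumCongr, component, component]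

theorem sum_injective :
    Injective fun Γ : LeggedRibbonGraph A₁ B₁ × LeggedRibbonGraph A₂ B₂ => Γ.1.sum Γ.2 := by
  rintro ⟨Γ₁, Γ₂⟩ ⟨Γ₁', Γ₂'⟩ h
  have hedge := @Perm.sumCongrHom_injective A₁ A₂ (_, _) (_, _) (congrArg edge h)
  have hvertex := @Perm.sumCongrHom_injective _ _ (_, _) (_, _)
    ((sumSumSumComm A₁ B₁ A₂ B₂).permCongr.injective (congrArg vertex h))
  rw [Prod.mk.injEq] at hedge hvertex ⊢
  exact ⟨LeggedRibbonGraph.ext hedge.1 hvertex.1, LeggedRibbonGraph.ext hedge.2 hvertex.2⟩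

theorem exists_eq_sum [Finite A₁] [Finite A₂] [Finite B₁] [Finite B₂]
    {Γ : LeggedRibbonGraph (A₁ ⊕ A₂) (B₁ ⊕ B₂)}
    (hedge : Set.MapsTo Γ.edge (Set.range Sum.inl) (Set.range Sum.inl))
    (hvertex : Set.MapsTo Γ.vertex (Set.range (Sum.map Sum.inl Sum.inl))
      (Set.range (Sum.map Sum.inl Sum.inl))) :
    ∃ (Γ₁ : LeggedRibbonGraph A₁ B₁) (Γ₂ : LeggedRibbonGraph A₂ B₂), Γ = Γ₁.sum Γ₂ := by
  obtain ⟨edge, vertex, edge_involutive, edge_ne, eq_of_sameCycle⟩ := Γ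
  obtain ⟨⟨α₁, α₂⟩, rfl⟩ := Perm.mem_sumCongrHom_range_of_perm_mapsTo_inl hedge
  obtain ⟨τ, rfl⟩ := (sumSumSumComm A₁ B₁ A₂ B₂).permCongr.surjective vertex
  obtain ⟨⟨τ₁, τ₂⟩, rfl⟩ : τ ∈ (Perm.sumCongrHom (A₁ ⊕ B₁) (A₂ ⊕ B₂)).range := by
    refine Perm.mem_sumCongrHom_range_of_perm_mapsTo_inl ?_
    rintro _ ⟨x, rfl⟩
    obtain ⟨y, hy⟩ := hvertex ⟨x, rfl⟩
    refine ⟨y, (sumSumSumComm A₁ B₁ A₂ B₂).injective ?_⟩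
    rcases x with x | x <;> rcases y with y | y <;> exact hy
  refine ⟨⟨α₁, τ₁, fun a => Sum.inl_injective (edge_involutive (.inl a)),
      fun a h => edge_ne (.inl a) (congrArg Sum.inl h), fun b b' h => ?_⟩,
    ⟨α₂, τ₂, fun a => Sum.inr_injective (edge_involutive (.inr a)),
      fun a h => edge_ne (.inr a) (congrArg Sum.inr h), fun b b' h => ?_⟩, rfl⟩
  · exact Sum.inl_injective (eq_of_sameCycle (.inl b) (.inl b') <|
      (sameCycle_permCongr_iff _ _).2 ((sameCycle_sumCongr_iff _ _).2 (.inl h)))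
  · exact Sum.inr_injective (eq_of_sameCycle (.inr b) (.inr b') <|
      (sameCycle_permCongr_iff _ _).2 ((sameCycle_sumCongr_iff _ _).2 (.inr h)))

theorem isConnected_iff_forall (Γ : LeggedRibbonGraph A B) (x : A ⊕ B) :
    Γ.IsConnected ↔ ∀ y, Γ.component x y :=
  Setoid.eq_top_iff.trans
    ⟨fun h => h x, fun h y z => Γ.component.trans (Γ.component.symm (h y)) (h z)⟩

theorem component_edge (Γ : LeggedRibbonGraph A B) (a : A) :
    Γ.component (.inl a) (.inl (Γ.edge a)) :=
  linked_apply_left _ _ (Sum.inl a)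

theorem component_vertex (Γ : LeggedRibbonGraph A B) (x : A ⊕ B) :
    Γ.component x (Γ.vertex x) :=
  linked_apply_right _ _ x

theorem setOf_component_sum_eq_range_iff (Γ₁ : LeggedRibbonGraph A₁ B₁)
    (Γ₂ : LeggedRibbonGraph A₂ B₂) (b : B₁) :
    {x | (Γ₁.sum Γ₂).component (.inr (.inl b)) x} = Set.range (Sum.map Sum.inl Sum.inl) ↔
      Γ₁.IsConnected := by
  have hcomponent (z : (A₁ ⊕ B₁) ⊕ (A₂ ⊕ B₂)) :
      (Γ₁.sum Γ₂).component (.inr (.inl b)) (sumSumSumComm A₁ B₁ A₂ B₂ z) ↔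
        Sum.LiftRel Γ₁.component Γ₂.component (.inl (.inr b)) z := by
    rw [component_sum, Setoid.comap_rel, symm_apply_apply]
    rfl
  have hrange (z : (A₁ ⊕ B₁) ⊕ (A₂ ⊕ B₂)) :
      sumSumSumComm A₁ B₁ A₂ B₂ z ∈ Set.range (Sum.map Sum.inl Sum.inl) ↔ z.isLeft := by
    rcases z with (z | z) | (z | z) <;> simp
  rw [Γ₁.isConnected_iff_forall (.inr b), Set.ext_iff,
    ← (sumSumSumComm A₁ B₁ A₂ B₂).forall_congr_right]
  simp only [Set.mem_ofPred_eq, hcomponent, hrange, Sum.forall (α := A₁ ⊕ B₁),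
    Sum.liftRel_inl_inl, Sum.not_liftRel_inl_inr, Sum.isLeft_inl, Sum.isLeft_inr, iff_true,
    Bool.false_eq_true, implies_true, and_true]

theorem exists_eq_sum_of_setOf_component_eq_range [Finite A₁] [Finite A₂] [Finite B₁] [Finite B₂]
    {Γ : LeggedRibbonGraph (A₁ ⊕ A₂) (B₁ ⊕ B₂)} {x : (A₁ ⊕ A₂) ⊕ (B₁ ⊕ B₂)}
    (h : {y | Γ.component x y} = Set.range (Sum.map Sum.inl Sum.inl)) :
    ∃ (Γ₁ : LeggedRibbonGraph A₁ B₁) (Γ₂ : LeggedRibbonGraph A₂ B₂), Γ = Γ₁.sum Γ₂ := by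
  apply exists_eq_sum
  · rintro _ ⟨a, rfl⟩
    obtain ⟨y, hy⟩ : .inl (Γ.edge (.inl a)) ∈
        Set.range (Sum.map (Sum.inl : A₁ → A₁ ⊕ A₂) (Sum.inl : B₁ → B₁ ⊕ B₂)) := by
      rw [← h]
      exact Γ.component.trans (h.ge ⟨.inl a, rfl⟩) (Γ.component_edge _)
    rcases y with y | y
    exacts [⟨y, Sum.inl_injective hy⟩, (Sum.inr_ne_inl hy).elim]
  · rw [← h]
    exact fun y hy => Γ.component.trans hy (Γ.component_vertex y)

theorem card_setOf_component_eq_range [Finite A₁] [Finite A₂] [Finite B₁] [Finite B₂] (b : B₁) :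
    Nat.card {Γ : LeggedRibbonGraph (A₁ ⊕ A₂) (B₁ ⊕ B₂) //
      {x | Γ.component (.inr (.inl b)) x} = Set.range (Sum.map Sum.inl Sum.inl)} =
    Nat.card {Γ : LeggedRibbonGraph A₁ B₁ // Γ.IsConnected} *
      Nat.card (LeggedRibbonGraph A₂ B₂) := by
  rw [← Nat.card_prod]
  refine (Nat.card_congr (.ofBijective (fun Γ =>
    ⟨Γ.1.1.sum Γ.2, (setOf_component_sum_eq_range_iff _ _ b).2 Γ.1.2⟩) ⟨?_, ?_⟩)).symm
  · rintro ⟨⟨Γ₁, h₁⟩, Γ₂⟩ ⟨⟨Γ₁', h₁'⟩, Γ₂'⟩ h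
    have := @sum_injective _ _ _ _ (_, _) (_, _) (congrArg Subtype.val h)
    simpa using this
  · rintro ⟨Γ, hΓ⟩
    obtain ⟨Γ₁, Γ₂, rfl⟩ := exists_eq_sum_of_setOf_component_eq_range hΓ
    exact ⟨(⟨Γ₁, (setOf_component_sum_eq_range_iff Γ₁ Γ₂ b).1 hΓ⟩, Γ₂), rfl⟩

end LeggedRibbonGraph

theorem sum_finset_card_eq_sum_antidiagonal (A : Type*) [Fintype A] (f : ℕ → ℕ → ℕ) :
    ∑ P : Finset A, f #P (Fintype.card A - #P) =
      ∑ p ∈ antidiagonal (Fintype.card A), (Fintype.card A).choose p.1 * f p.1 p.2 := by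
  rw [← powerset_univ, sum_powerset_apply_card fun m => f m (Fintype.card A - m),
    Nat.sum_antidiagonal_eq_sum_range_succ fun i j => (Fintype.card A).choose i * f i j]
  rfl

namespace LeggedRibbonGraph

/-- The number of ribbon graphs with half-edges `Fin n` and legs `Fin N`. -/
noncomputable def count (n N : ℕ) : ℕ :=
  Nat.card (LeggedRibbonGraph (Fin n) (Fin N))

/-- The number of connected ribbon graphs with half-edges `Fin n` and legs `Fin N`. -/
noncomputable def connectedCount (n N : ℕ) : ℕ :=
  Nat.card {Γ : LeggedRibbonGraph (Fin n) (Fin N) // Γ.IsConnected}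

theorem connectedCount_le_count (n N : ℕ) : connectedCount n N ≤ count n N :=
  Finite.card_subtype_le _

variable {A B : Type*} [Fintype A] [Fintype B]

theorem card_eq_count :
    Nat.card (LeggedRibbonGraph A B) = count (Fintype.card A) (Fintype.card B) :=
  Nat.card_congr (relabelEquiv (Fintype.equivFin A) (Fintype.equivFin B))

theorem card_isConnected_eq_connectedCount :
    Nat.card {Γ : LeggedRibbonGraph A B // Γ.IsConnected} =
      connectedCount (Fintype.card A) (Fintype.card B) :=
  Nat.card_congr ((relabelEquiv (Fintype.equivFin A) (Fintype.equivFin B)).subtypeEquiv fun Γ =>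
    (isConnected_relabel_iff _ _ Γ).symm)

theorem card_setOf_component_eq_disjSum (P : Finset A) {Q : Finset B} {b : B} (hb : b ∈ Q) :
    Nat.card {Γ : LeggedRibbonGraph A B // {x | Γ.component (.inr b) x} = P.disjSum Q} =
      connectedCount #P #Q * count (Fintype.card A - #P) (Fintype.card B - #Q) := by
  classical
  let e := Equiv.sumCompl (· ∈ P)
  let e' := Equiv.sumCompl (· ∈ Q)
  have hcard := card_setOf_component_eq_range (A₁ := {a // a ∈ P}) (A₂ := {a // a ∉ P})
    (B₂ := {b // b ∉ Q}) (⟨b, hb⟩ : {b // b ∈ Q})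
  rw [card_isConnected_eq_connectedCount, card_eq_count] at hcard
  simp only [Fintype.card_coe, Fintype.card_subtype_compl] at hcard
  rw [← hcard]
  refine (Nat.card_congr ((relabelEquiv e e').subtypeEquiv fun Γ => ?_)).symm
  have hrange (z : ({a // a ∈ P} ⊕ {a // a ∉ P}) ⊕ ({b // b ∈ Q} ⊕ {b // b ∉ Q})) :
      z ∈ Set.range (Sum.map Sum.inl Sum.inl) ↔ sumCongr e e' z ∈ P.disjSum Q := by
    rcases z with (z | z) | (z | z) <;> simp [e, e', z.2]
  have hcomponent (z : ({a // a ∈ P} ⊕ {a // a ∉ P}) ⊕ ({b // b ∈ Q} ⊕ {b // b ∉ Q})) :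
      (relabelEquiv e e' Γ).component (.inr b) (sumCongr e e' z) ↔
        Γ.component (.inr (.inl ⟨b, hb⟩)) z := by
    rw [relabelEquiv, coe_fn_mk, component_relabel, Setoid.comap_rel, symm_apply_apply]
    simp [e', Equiv.sumCompl_symm_apply_of_pos hb]
  simp only [Set.ext_iff, (sumCongr e e').surjective.forall, Set.mem_ofPred_eq, hcomponent,
    hrange, mem_coe]

theorem card_setOf_component_none_eq (P : Finset A) (Q : Finset B) :
    Nat.card {Γ : LeggedRibbonGraph A (Option B) //
      {x | Γ.component (.inr none) x} = P.disjSum (insertNone Q)} =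
      connectedCount #P (#Q + 1) * count (Fintype.card A - #P) (Fintype.card B - #Q) := by
  rw [card_setOf_component_eq_disjSum P (none_mem_insertNone (s := Q)), card_insertNone,
    Fintype.card_option, Nat.add_sub_add_right]

theorem card_option_eq_sum_finset :
    Nat.card (LeggedRibbonGraph A (Option B)) = ∑ P : Finset A, ∑ Q : Finset B,
      connectedCount #P (#Q + 1) * count (Fintype.card A - #P) (Fintype.card B - #Q) := by
  classical
  let part (Γ : LeggedRibbonGraph A (Option B)) : Finset A × Finset B :=
    (univ.filter fun a => Γ.component (.inr none) (.inl a),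
      univ.filter fun b => Γ.component (.inr none) (.inr (some b)))
  rw [Nat.card_congr (Equiv.sigmaFiberEquiv part).symm, Nat.card_sigma, Fintype.sum_prod_type]
  refine sum_congr rfl fun P _ => sum_congr rfl fun Q _ => ?_
  rw [← card_setOf_component_none_eq]
  refine Nat.card_congr (Equiv.subtypeEquivRight fun Γ => ?_)
  simp [part, Prod.ext_iff, Finset.ext_iff, Set.ext_iff, Option.forall]

theorem count_succ (n N : ℕ) :
    count n (N + 1) = ∑ p ∈ antidiagonal n, n.choose p.1 * ∑ q ∈ antidiagonal N,
      N.choose q.1 * (connectedCount p.1 (q.1 + 1) * count p.2 q.2) := by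
  have hn := sum_finset_card_eq_sum_antidiagonal (Fin n) fun i j =>
    ∑ q ∈ antidiagonal N, N.choose q.1 * (connectedCount i (q.1 + 1) * count j q.2)
  have hN (i j : ℕ) := sum_finset_card_eq_sum_antidiagonal (Fin N) fun k l =>
    connectedCount i (k + 1) * count j l
  simp only [Fintype.card_fin] at hn hN
  rw [← hn]
  simp only [← hN]
  simpa [card_eq_count] using card_option_eq_sum_finset (A := Fin n) (B := Fin N)

end LeggedRibbonGraph

section SeparatingPermutations

variable {V W A B : Type*}

/-- A permutation separates a family of points if they lie on pairwise different cycles of it. -/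
def Separates (τ : Perm V) (r : B → V) : Prop :=
  ∀ b b', τ.SameCycle (r b) (r b') → b = b'

theorem separates_permCongr_iff (e : V ≃ W) {τ : Perm V} {r : B → V} :
    Separates (e.permCongr τ) (e ∘ r) ↔ Separates τ r := by
  simp [Separates, sameCycle_permCongr_iff]

theorem sameCycle_decomposeOption_symm_iff [DecidableEq V] (a : Option V) (τ : Perm V) {x y : V} :
    (Perm.decomposeOption.symm (a, τ)).SameCycle (some x) (some y) ↔ τ.SameCycle x y := by
  set υ := Perm.decomposeOption.symm (a, τ) with hυ
  have apply_none : υ none = a := by simp [hυ]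
  have apply_some (z : V) : υ (some z) = if some (τ z) = a then none else some (τ z) := by
    simp [hυ, swap_apply_def]
  constructor
  · refine sameCycle_map (fun o : Option V => o.getD (a.getD x)) ?_
    rintro (_ | z)
    · rw [apply_none]
      cases a <;> rfl
    · rw [apply_some]
      split_ifs with hz
      · exact ⟨1, by simp [← hz]⟩
      · exact ⟨1, rfl⟩
  · refine sameCycle_map some fun z => ?_
    by_cases hz : some (τ z) = a
    · exact ⟨2, by simp [sq, apply_some, hz, apply_none]⟩
    · exact ⟨1, by simp [apply_some, hz]⟩

theorem card_separates_option [Finite V] (r : B → V) :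
    Nat.card {τ : Perm (Option V) // Separates τ (some ∘ r)} =
      (Nat.card V + 1) * Nat.card {τ : Perm V // Separates τ r} := by
  classical
  have hseparates (υ : Perm (Option V)) :
      Separates υ (some ∘ r) ↔
        Separates (Perm.decomposeOption.trans (prodComm _ _) υ).1 r := by
    obtain ⟨⟨a, τ⟩, rfl⟩ := Perm.decomposeOption.symm.surjective υ
    simp only [Separates, trans_apply, apply_symm_apply, prodComm_apply, Prod.fst_swap, comp_apply,
      sameCycle_decomposeOption_symm_iff]
  rw [← Finite.card_option, mul_comm, ← Nat.card_prod]
  exact Nat.card_congr ((subtypeEquiv _ hseparates).trans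
    (prodSubtypeFstEquivSubtypeProd (p := fun τ : Perm V => Separates τ r)))

theorem separates_inr_iff_eq_one [IsEmpty A] {τ : Perm (A ⊕ B)} :
    Separates τ Sum.inr ↔ τ = 1 := by
  refine ⟨fun h => ?_, ?_⟩
  · ext x
    obtain ⟨b, rfl⟩ := (emptySum A B).symm.surjective x
    obtain ⟨b', hb'⟩ := (emptySum A B).symm.surjective (τ (.inr b))
    exact hb'.symm.trans (congrArg Sum.inr (h b b' ⟨1, hb'.symm⟩).symm)
  · rintro rfl b b' h
    simpa using h

theorem card_separates_inr_mul_factorial [Finite A] [Finite B] :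
    Nat.card {τ : Perm (A ⊕ B) // Separates τ Sum.inr} * (Nat.card B)! =
      (Nat.card A + Nat.card B)! := by
  induction A using Finite.induction_empty_option with
  | of_equiv e h =>
    rw [← Nat.card_congr e, ← h]
    congr 1
    exact (Nat.card_congr ((sumCongr e (.refl B)).permCongr.subtypeEquiv fun τ =>
      (separates_permCongr_iff (sumCongr e (.refl B))).symm)).symm
  | h_empty =>
    simp [separates_inr_iff_eq_one]
  | @h_option A _ ih =>
    let e : Option A ⊕ B ≃ Option (A ⊕ B) :=
      { toFun := Sum.elim (Option.map Sum.inl) (some ∘ Sum.inr)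
        invFun := fun o => o.elim (.inl none) (Sum.map some id)
        left_inv := by rintro ((_ | a) | b) <;> rfl
        right_inv := by rintro (_ | (a | b)) <;> rfl }
    rw [Nat.card_congr (e.permCongr.subtypeEquiv (q := fun τ => Separates τ (some ∘ Sum.inr))
      fun τ => (separates_permCongr_iff e).symm),
      card_separates_option, Nat.card_sum, mul_assoc, ih, Finite.card_option,
      add_right_comm _ 1, Nat.factorial_succ]

end SeparatingPermutations

section FixedPointFreeInvolutions

variable {V : Type*} [Fintype V]

theorem involutive_and_ne_iff_cycleType_eq_replicate [DecidableEq V] {α : Perm V} :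
    (Involutive α ∧ ∀ x, α x ≠ x) ↔
      ∃ k, Fintype.card V = 2 * k ∧ α.cycleType = Multiset.replicate k 2 := by
  have hsq : Involutive α ↔ α ^ 2 = 1 := by simp [Perm.ext_iff, sq, Involutive]
  have hsupport : (∀ x, α x ≠ x) ↔ α.cycleType.sum = Fintype.card V := by
    rw [Perm.sum_cycleType, card_eq_iff_eq_univ, eq_univ_iff_forall]
    simp only [Perm.mem_support]
  rw [hsq, hsupport]
  constructor
  · rintro ⟨hα, hsum⟩
    have hcycleType := Perm.cycleType_of_pow_prime_eq_one hα
    refine ⟨_, ?_, hcycleType⟩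
    rw [← hsum, hcycleType]
    simp [mul_comm]
  · rintro ⟨k, hk, hcycleType⟩
    rw [Perm.pow_prime_eq_one_iff, hcycleType, Multiset.sum_replicate, smul_eq_mul, hk, mul_comm]
    exact ⟨fun c => Multiset.eq_of_mem_replicate, rfl⟩

theorem card_cycleType_eq_replicate_two [DecidableEq V] {k : ℕ} (hk : Fintype.card V = 2 * k) :
    Nat.card {α : Perm V // α.cycleType = Multiset.replicate k 2} = (2 * k - 1)‼ := by
  have hcard := Perm.card_of_cycleType_mul_eq V (Multiset.replicate k 2)
  rw [if_pos ⟨by simp [hk, mul_comm], fun a ha => (Multiset.eq_of_mem_replicate ha).ge⟩] at hcard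
  have hcount : ∏ m ∈ (Multiset.replicate k 2).toFinset, ((Multiset.replicate k 2).count m)! =
      k ! := by
    rcases eq_or_ne k 0 with rfl | hk
    · rfl
    · rw [Multiset.toFinset_replicate, if_neg hk, prod_singleton, Multiset.count_replicate_self]
  rw [hcount, hk, Multiset.sum_replicate, Multiset.prod_replicate, smul_eq_mul, mul_comm k,
    Nat.sub_self, Nat.factorial_zero, one_mul, ← Nat.doubleFactorial_two_mul] at hcard
  rw [Nat.card_eq_fintype_card, Fintype.card_subtype]
  refine Nat.eq_of_mul_eq_mul_right (Nat.doubleFactorial_pos (2 * k)) (hcard.trans ?_)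
  rcases k with _ | k
  · rfl
  · exact (Nat.factorial_eq_mul_doubleFactorial (2 * k + 1)).trans (mul_comm _ _)

theorem card_involutive_and_ne :
    Nat.card {α : Perm V // Involutive α ∧ ∀ x, α x ≠ x} =
      if Even (Fintype.card V) then (Fintype.card V - 1)‼ else 0 := by
  classical
  simp only [involutive_and_ne_iff_cycleType_eq_replicate]
  split_ifs with h
  · obtain ⟨k, hk⟩ := even_iff_exists_two_mul.1 h
    rw [hk, ← card_cycleType_eq_replicate_two hk]
    refine Nat.card_congr (subtypeEquivRight fun α => ⟨?_, fun hα => ⟨k, rfl, hα⟩⟩)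
    rintro ⟨l, hl, hα⟩
    rwa [Nat.eq_of_mul_eq_mul_left two_pos hl]
  · refine Nat.card_eq_zero.2 (.inl ⟨?_⟩)
    rintro ⟨α, k, hk, -⟩
    exact h (even_iff_exists_two_mul.2 ⟨k, hk⟩)

end FixedPointFreeInvolutions

namespace LeggedRibbonGraph

variable {A B : Type*}

/-- The edges and the vertices of a ribbon graph can be chosen independently. -/
def equivProd : LeggedRibbonGraph A B ≃
    {α : Perm A // Involutive α ∧ ∀ x, α x ≠ x} ×
      {τ : Perm (A ⊕ B) // Separates τ Sum.inr} where
  toFun Γ := (⟨Γ.edge, Γ.edge_involutive, Γ.edge_ne⟩, ⟨Γ.vertex, Γ.eq_of_sameCycle⟩)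
  invFun q := ⟨q.1, q.2, q.1.2.1, q.1.2.2, q.2.2⟩

theorem count_mul_factorial (n N : ℕ) :
    count n N * N ! = if Even n then (n - 1)‼ * (n + N)! else 0 := by
  have hvertex := card_separates_inr_mul_factorial (A := Fin n) (B := Fin N)
  rw [Nat.card_fin, Nat.card_fin] at hvertex
  rw [count, Nat.card_congr equivProd, Nat.card_prod, card_involutive_and_ne, Fintype.card_fin,
    mul_assoc, hvertex, ite_mul, zero_mul]

theorem connectedCount_of_not_even {n : ℕ} (hn : ¬ Even n) (N : ℕ) : connectedCount n N = 0 := by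
  have hcount := count_mul_factorial n N
  rw [if_neg hn] at hcount
  have := connectedCount_le_count n N
  simp_all [N.factorial_ne_zero]

theorem isConnected_iff_subsingleton [IsEmpty A] (Γ : LeggedRibbonGraph A B) :
    Γ.IsConnected ↔ Subsingleton B := by
  have hcomponent : Γ.component = ⊥ := by
    have hvertex : Γ.vertex = 1 := separates_inr_iff_eq_one.1 Γ.eq_of_sameCycle
    refine le_bot_iff.1 (linked_le_iff.2 ⟨?_, fun x => ?_⟩)
    · rintro (a | b)
      exacts [isEmptyElim a, rfl]
    · rw [hvertex]
      rfl
  rw [IsConnected, hcomponent, Setoid.eq_top_iff, Setoid.bot_def, subsingleton_iff]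
  simp

theorem connectedCount_zero {N : ℕ} (hN : N ≠ 0) :
    connectedCount 0 N = if N = 1 then 1 else 0 := by
  have hcount : count 0 N = 1 := by
    have := count_mul_factorial 0 N
    simpa [N.factorial_ne_zero] using this
  have hsubsingleton : Subsingleton (Fin N) ↔ N = 1 := by
    rw [Fin.subsingleton_iff_le_one]
    omega
  simp only [connectedCount, isConnected_iff_subsingleton, hsubsingleton]
  split_ifs with h
  · simpa [h, count] using hcount
  · simp [h]

end LeggedRibbonGraph

section InsertRoots

variable {A B : Type*}

theorem exists_eq_sumCongr_one [Finite A] [Finite B] {τ : Perm (A ⊕ B)}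
    (hτ : ∀ b, τ (.inr b) = .inr b) : ∃ σ : Perm A, τ = sumCongr σ 1 := by
  have hmaps : Set.MapsTo τ (Set.range Sum.inl) (Set.range Sum.inl) := by
    rw [Perm.perm_mapsTo_inl_iff_mapsTo_inr]
    rintro _ ⟨b, rfl⟩
    exact ⟨b, (hτ b).symm⟩
  obtain ⟨⟨σ, υ⟩, rfl⟩ := Perm.mem_sumCongrHom_range_of_perm_mapsTo_inl hmaps
  obtain rfl : υ = 1 := Perm.ext fun b => Sum.inr_injective (hτ b)
  exact ⟨σ, rfl⟩

/-- The involution of `A ⊕ B` that exchanges each `b : B` with its image in `A`. -/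
noncomputable def rootSwap (r : B ↪ A) : Perm (A ⊕ B) :=
  Perm.viaEmbedding (sumComm B B) (r.sumMap (.refl B))

theorem rootSwap_inr (r : B ↪ A) (b : B) : rootSwap r (.inr b) = .inl (r b) :=
  Perm.viaEmbedding_apply _ (r.sumMap (.refl B)) (.inr b)

theorem rootSwap_inl_apply (r : B ↪ A) (b : B) : rootSwap r (.inl (r b)) = .inr b :=
  Perm.viaEmbedding_apply _ (r.sumMap (.refl B)) (.inl b)

theorem rootSwap_inl_of_notMem (r : B ↪ A) {a : A} (ha : a ∉ Set.range r) :
    rootSwap r (.inl a) = .inl a := by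
  refine Perm.viaEmbedding_apply_of_notMem _ _ _ ?_
  rintro ⟨b | b, hb⟩
  exacts [ha ⟨b, Sum.inl_injective hb⟩, Sum.inr_ne_inl hb]

theorem rootSwap_mul_self (r : B ↪ A) : rootSwap r * rootSwap r = 1 := by
  ext (a | b) : 1
  · by_cases ha : a ∈ Set.range r
    · obtain ⟨b, rfl⟩ := ha
      simp [rootSwap_inl_apply, rootSwap_inr]
    · simp [rootSwap_inl_of_notMem r ha]
  · simp [rootSwap_inl_apply, rootSwap_inr]

/-- The permutation obtained from `σ` by inserting each `b : B` into the cycle of `r b`, just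
before `r b`. -/
noncomputable def insertRoots (r : B ↪ A) (σ : Perm A) : Perm (A ⊕ B) :=
  rootSwap r * sumCongr σ 1

theorem insertRoots_inr (r : B ↪ A) (σ : Perm A) (b : B) :
    insertRoots r σ (.inr b) = .inl (r b) :=
  rootSwap_inr r b

theorem insertRoots_injective : Injective fun p : (B ↪ A) × Perm A => insertRoots p.1 p.2 := by
  rintro ⟨r, σ⟩ ⟨s, τ⟩ (h : insertRoots r σ = insertRoots s τ)
  obtain rfl : r = s := by
    ext b
    have hb := congrArg (· (Sum.inr b)) h
    simpa only [insertRoots_inr, Sum.inl.injEq] using hb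
  have hsumCongr := @Perm.sumCongrHom_injective _ _ (_, _) (_, _) (mul_left_cancel h)
  exact congrArg (r, ·) (congrArg Prod.fst hsumCongr)

theorem exists_eq_insertRoots [Finite A] [Finite B] {τ : Perm (A ⊕ B)}
    (hτ : ∀ b, ∃ a, τ (.inr b) = .inl a) : ∃ (r : B ↪ A) (σ : Perm A), τ = insertRoots r σ := by
  choose r hr using hτ
  have hinj : Injective r := fun b b' h =>
    Sum.inr_injective (τ.injective (by rw [hr, hr, h]))
  obtain ⟨σ, hσ⟩ := exists_eq_sumCongr_one (τ := rootSwap ⟨r, hinj⟩ * τ) fun b => by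
    rw [Perm.mul_apply, hr]
    exact rootSwap_inl_apply ⟨r, hinj⟩ b
  exact ⟨⟨r, hinj⟩, σ, by rw [insertRoots, ← hσ, ← mul_assoc, rootSwap_mul_self, one_mul]⟩

theorem sameCycle_insertRoots_iff (r : B ↪ A) (σ : Perm A) {x y : A ⊕ B} :
    (insertRoots r σ).SameCycle x y ↔ σ.SameCycle (Sum.elim id r x) (Sum.elim id r y) := by
  have hretract (x : A ⊕ B) : (insertRoots r σ).SameCycle x (.inl (Sum.elim id r x)) := by
    rcases x with a | b
    exacts [.rfl, ⟨1, insertRoots_inr r σ b⟩]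
  constructor
  · refine sameCycle_map _ ?_
    rintro (a | b)
    · refine ⟨1, ?_⟩
      by_cases ha : σ a ∈ Set.range r
      · obtain ⟨b, hb⟩ := ha
        simp [insertRoots, ← hb, rootSwap_inl_apply]
      · simp [insertRoots, rootSwap_inl_of_notMem r ha]
    · rw [insertRoots_inr]
      rfl
  · refine fun h => (hretract x).trans (.trans ?_ (hretract y).symm)
    refine sameCycle_map Sum.inl (fun a => ?_) h
    by_cases ha : σ a ∈ Set.range r
    · obtain ⟨b, hb⟩ := ha
      exact ⟨2, by simp [sq, insertRoots, ← hb, rootSwap_inl_apply, rootSwap_inr]⟩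
    · exact ⟨1, by simp [insertRoots, rootSwap_inl_of_notMem r ha]⟩

theorem linked_insertRoots (r : B ↪ A) (α σ : Perm A) :
    linked (sumCongr α 1) (insertRoots r σ) = (linked α σ).comap (Sum.elim id r) := by
  have hsameCycle {x y : A ⊕ B} (h : σ.SameCycle (Sum.elim id r x) (Sum.elim id r y)) :
      linked (sumCongr α 1) (insertRoots r σ) x y :=
    sameCycle_setoid_le (linked_apply_right _ _) ((sameCycle_insertRoots_iff r σ).2 h)
  refine le_antisymm (linked_le_iff.2 ⟨?_, fun x => ?_⟩) fun x y h => ?_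
  · rintro (a | b)
    exacts [linked_apply_left α σ a, Setoid.refl' _ _]
  · exact sameCycle_setoid_le (linked_apply_right α σ)
      ((sameCycle_insertRoots_iff r σ).1 ⟨1, rfl⟩)
  · have hle : linked α σ ≤ (linked (sumCongr α 1) (insertRoots r σ)).comap Sum.inl :=
      linked_le_iff.2 ⟨fun a => linked_apply_left (sumCongr α 1) _ (Sum.inl a),
        fun a => hsameCycle ⟨1, rfl⟩⟩
    exact Setoid.trans' _ (hsameCycle (y := .inl _) .rfl)
      (Setoid.trans' _ (hle h) (hsameCycle (x := .inl _) .rfl))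

theorem linked_insertRoots_eq_top_iff (r : B ↪ A) (α σ : Perm A) :
    linked (sumCongr α 1) (insertRoots r σ) = ⊤ ↔ linked α σ = ⊤ := by
  rw [linked_insertRoots, Setoid.eq_top_iff, Setoid.eq_top_iff]
  exact ⟨fun h a a' => h (.inl a) (.inl a'), fun h x y => h _ _⟩

end InsertRoots

namespace LeggedRibbonGraph

theorem IsConnected.exists_vertex_inr_eq_inl {A B : Type*} [Nonempty A]
    {Γ : LeggedRibbonGraph A B} (hΓ : Γ.IsConnected) (b : B) : ∃ a, Γ.vertex (.inr b) = .inl a := by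
  rcases hb : Γ.vertex (.inr b) with a | b'
  · exact ⟨a, rfl⟩
  obtain rfl := Γ.eq_of_sameCycle b b' ⟨1, hb⟩
  have hle : Γ.component ≤ Setoid.ker (· = Sum.inr b) := by
    refine linked_le_iff.2 ⟨?_, fun x => ?_⟩
    · rintro (a | b') <;> simp [Setoid.ker_def]
    · simp only [Setoid.ker_def, eq_iff_iff]
      rw [← Γ.vertex.apply_eq_iff_eq, hb]
  obtain ⟨a⟩ := ‹Nonempty A›
  have hne := hle (Setoid.eq_top_iff.1 hΓ (.inr b) (.inl a))
  simp [Setoid.ker_def] at hne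

end LeggedRibbonGraph

namespace NRootedGraph

variable {N e : ℕ}

theorem ext_of_root {Γ Γ' : NRootedGraph N e} (hα : Γ.α = Γ'.α) (hσ : Γ.σ = Γ'.σ)
    (hroot : Γ.root = Γ'.root) : Γ = Γ' := by
  obtain ⟨⟨_, _, _, _, _⟩, _, _⟩ := Γ
  obtain ⟨⟨_, _, _, _, _⟩, _, _⟩ := Γ'
  congr

theorem linked_eq_top (Γ : NRootedGraph N e) : linked Γ.α Γ.σ = ⊤ :=
  linked_eq_top_iff_isPretransitive.2 Γ.transitive

theorem separates_root (Γ : NRootedGraph N e) : Separates Γ.σ Γ.root := fun i j =>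
  not_imp_not.1 (Γ.root_distinct i j)

instance : MulAction (Perm (Fin (2 * e))) (NRootedGraph N e) where
  smul ψ Γ :=
    { α := ψ.permCongr Γ.α
      σ := ψ.permCongr Γ.σ
      involutive := fun x => by simp [Γ.involutive _]
      fixedPointFree := fun x => by
        simpa [← ψ.eq_symm_apply] using Γ.fixedPointFree (ψ.symm x)
      transitive := by
        rw [← linked_eq_top_iff_isPretransitive, linked_permCongr, Γ.linked_eq_top]
        rfl
      root := ψ ∘ Γ.root
      root_distinct := fun i j =>
        mt ((separates_permCongr_iff ψ).2 Γ.separates_root i j) }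
  one_smul _ := rfl
  mul_smul _ _ _ := rfl

theorem α_smul (ψ : Perm (Fin (2 * e))) (Γ : NRootedGraph N e) : (ψ • Γ).α = ψ.permCongr Γ.α :=
  rfl

theorem σ_smul (ψ : Perm (Fin (2 * e))) (Γ : NRootedGraph N e) : (ψ • Γ).σ = ψ.permCongr Γ.σ :=
  rfl

theorem orbitRel_eq_setoid :
    MulAction.orbitRel (Perm (Fin (2 * e))) (NRootedGraph N e) = setoid N e := by
  refine Setoid.ext fun Γ Γ' => Iff.trans ⟨?_, ?_⟩ (setoid N e).comm'
  · rintro ⟨ψ, rfl⟩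
    refine ⟨ψ, ?_, ?_, fun i => rfl⟩
    · exact Perm.ext fun x => congrArg (ψ ∘ Γ'.α) (ψ.symm_apply_apply x)
    · exact Perm.ext fun x => congrArg (ψ ∘ Γ'.σ) (ψ.symm_apply_apply x)
  · rintro ⟨ψ, hα, hσ, hroot⟩
    refine ⟨ψ, ext_of_root ?_ ?_ (funext hroot)⟩
    · exact (eq_mul_inv_of_mul_eq hα).symm
    · exact (eq_mul_inv_of_mul_eq hσ).symm

theorem stabilizer_eq_bot (hN : N ≠ 0) (Γ : NRootedGraph N e) :
    MulAction.stabilizer (Perm (Fin (2 * e))) Γ = ⊥ := by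
  refine eq_bot_iff.2 fun ψ (hψ : ψ • Γ = Γ) => Perm.ext fun x => ?_
  have hα (y) : ψ (Γ.α y) = Γ.α (ψ y) := by
    simpa [α_smul] using congrArg (fun Δ => Δ.α (ψ y)) hψ
  have hσ (y) : ψ (Γ.σ y) = Γ.σ (ψ y) := by
    simpa [σ_smul] using congrArg (fun Δ => Δ.σ (ψ y)) hψ
  let i : Fin N := ⟨0, Nat.pos_of_ne_zero hN⟩
  have hroot : ψ (Γ.root i) = Γ.root i := congrFun (congrArg root hψ) i
  have hle : linked Γ.α Γ.σ ≤ Setoid.ker fun y => ψ y = y :=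
    linked_le_iff.2 ⟨fun y => by simp [Setoid.ker_def, hα], fun y => by simp [Setoid.ker_def, hσ]⟩
  rw [Γ.linked_eq_top] at hle
  exact (hle (x := Γ.root i) (y := x) trivial).mp hroot

theorem card_eq_factorial_mul_card_quotient (hN : N ≠ 0) :
    Nat.card (NRootedGraph N e) = (2 * e)! * Nat.card (Quotient (setoid N e)) := by
  rw [Nat.card_congr (MulAction.selfEquivOrbitsQuotientProd (stabilizer_eq_bot hN)), Nat.card_prod,
    Nat.card_perm, Nat.card_fin, mul_comm, ← orbitRel_eq_setoid]

/-- The roots of a rooted map, as an embedding. -/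
def rootEmbedding (Γ : NRootedGraph N e) : Fin N ↪ Fin (2 * e) :=
  ⟨Γ.root, fun i j h => Γ.separates_root i j (h ▸ .rfl)⟩

/-- The ribbon graph obtained from a rooted map by inserting, for each root, a leg just before the
rooted half-edge. -/
noncomputable def toLegged (Γ : NRootedGraph N e) : LeggedRibbonGraph (Fin (2 * e)) (Fin N) where
  edge := Γ.α
  vertex := insertRoots Γ.rootEmbedding Γ.σ
  edge_involutive := Γ.involutive
  edge_ne := Γ.fixedPointFree
  eq_of_sameCycle i j h := Γ.separates_root i j ((sameCycle_insertRoots_iff _ _).1 h)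

theorem isConnected_toLegged (Γ : NRootedGraph N e) : Γ.toLegged.IsConnected :=
  (linked_insertRoots_eq_top_iff _ _ _).2 Γ.linked_eq_top

theorem toLegged_injective : Injective (toLegged : NRootedGraph N e → _) := fun Γ Γ' h => by
  have hinsert := @insertRoots_injective _ _ (_, _) (_, _) (congrArg LeggedRibbonGraph.vertex h)
  rw [Prod.mk.injEq] at hinsert
  exact ext_of_root (congrArg LeggedRibbonGraph.edge h) hinsert.2 (congrArg (⇑) hinsert.1)

theorem exists_toLegged_eq (he : e ≠ 0) {Γ : LeggedRibbonGraph (Fin (2 * e)) (Fin N)}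
    (hΓ : Γ.IsConnected) : ∃ Γ' : NRootedGraph N e, Γ'.toLegged = Γ := by
  have : Nonempty (Fin (2 * e)) := ⟨⟨0, by omega⟩⟩
  obtain ⟨r, σ, hvertex⟩ := exists_eq_insertRoots hΓ.exists_vertex_inr_eq_inl
  rw [LeggedRibbonGraph.IsConnected, LeggedRibbonGraph.component, hvertex,
    linked_insertRoots_eq_top_iff, linked_eq_top_iff_isPretransitive] at hΓ
  refine ⟨⟨⟨Γ.edge, σ, Γ.edge_involutive, Γ.edge_ne, hΓ⟩, r, fun i j => mt fun h => ?_⟩,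
    LeggedRibbonGraph.ext rfl hvertex.symm⟩
  refine Γ.eq_of_sameCycle i j ?_
  rw [hvertex]
  exact (sameCycle_insertRoots_iff r σ).2 h

theorem card_eq_connectedCount (he : e ≠ 0) :
    Nat.card (NRootedGraph N e) = LeggedRibbonGraph.connectedCount (2 * e) N :=
  Nat.card_congr <| .ofBijective (fun Γ => ⟨Γ.toLegged, Γ.isConnected_toLegged⟩)
    ⟨fun _ _ h => toLegged_injective (congrArg Subtype.val h), fun ⟨_, hΓ⟩ =>
      (exists_toLegged_eq he hΓ).imp fun _ => Subtype.ext⟩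

end NRootedGraph

theorem connectedCount_two_mul {N : ℕ} (hN : N ≠ 0) (e : ℕ) :
    LeggedRibbonGraph.connectedCount (2 * e) N = (2 * e)! * numNRootedMaps N e := by
  rw [numNRootedMaps]
  split_ifs with he hN'
  · rw [he, mul_zero, LeggedRibbonGraph.connectedCount_zero hN, if_pos hN', Nat.factorial_zero]
  · rw [he, mul_zero, LeggedRibbonGraph.connectedCount_zero hN, if_neg hN', mul_zero]
  · rw [← NRootedGraph.card_eq_connectedCount he,
      NRootedGraph.card_eq_factorial_mul_card_quotient hN]

section GeneratingFunctions

open PowerSeries LeggedRibbonGraph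

/-- The bivariate exponential generating function of `a`, as a power series in the variable of the
second index whose coefficients are power series in the variable of the first. -/
noncomputable def egf (a : ℕ → ℕ → ℕ) : ℚ⟦X⟧⟦X⟧ :=
  mk fun N => mk fun n => (a n N : ℚ) / (n ! * N !)

theorem coeff_coeff_egf (a : ℕ → ℕ → ℕ) (n N : ℕ) :
    coeff n (coeff N (egf a)) = (a n N : ℚ) / (n ! * N !) := by
  rw [egf, coeff_mk, coeff_mk]

theorem coeff_derivative_egf (a : ℕ → ℕ → ℕ) (n N : ℕ) :
    coeff n (coeff N (d⁄dX ℚ⟦X⟧ (egf a))) = (a n (N + 1) : ℚ) / (n ! * N !) := by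
  rw [coeff_derivative, ← Nat.cast_succ, ← map_natCast (C (R := ℚ)), coeff_mul_C,
    coeff_coeff_egf, Nat.factorial_succ]
  push_cast
  field_simp

/-- The exponential formula, in the variable of the second index: the part containing a
distinguished label is split off. -/
theorem derivative_egf_eq_mul {w c : ℕ → ℕ → ℕ}
    (h : ∀ n N, w n (N + 1) = ∑ p ∈ antidiagonal n, n.choose p.1 *
      ∑ q ∈ antidiagonal N, N.choose q.1 * (c p.1 (q.1 + 1) * w p.2 q.2)) :
    d⁄dX ℚ⟦X⟧ (egf w) = d⁄dX ℚ⟦X⟧ (egf c) * egf w := by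
  ext N n
  rw [coeff_derivative_egf, h, coeff_mul, map_sum]
  simp only [coeff_mul, coeff_derivative_egf, coeff_coeff_egf]
  rw [sum_comm, Nat.cast_sum, sum_div]
  refine sum_congr rfl fun p hp => ?_
  rw [Nat.cast_mul, Nat.cast_sum, mul_sum, sum_div]
  refine sum_congr rfl fun q hq => ?_
  obtain rfl := mem_antidiagonal.1 hp
  obtain rfl := mem_antidiagonal.1 hq
  push_cast
  rw [Nat.cast_add_choose, Nat.cast_add_choose]
  field_simp

theorem coeff_egf_count (N : ℕ) : coeff N (egf count) = ((N ! : ℚ) ^ 2)⁻¹ • genZ N := by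
  ext n
  have hcount := congrArg (Nat.cast (R := ℚ)) (count_mul_factorial n N)
  push_cast at hcount
  rw [coeff_coeff_egf, coeff_smul, smul_eq_mul, genZ, coeff_mk]
  rw [← eq_div_iff (by positivity)] at hcount
  rw [hcount]
  split_ifs
  · field_simp
  · simp

theorem coeff_egf_connectedCount {N : ℕ} (hN : N ≠ 0) :
    coeff N (egf connectedCount) = (N ! : ℚ)⁻¹ • genNRootedMaps N := by
  ext n
  rw [coeff_coeff_egf, coeff_smul, smul_eq_mul, genNRootedMaps, coeff_mk]
  split_ifs with hn
  · obtain ⟨e, rfl⟩ := even_iff_exists_two_mul.1 hn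
    rw [Nat.mul_div_cancel_left e two_pos, connectedCount_two_mul hN]
    push_cast
    field_simp
  · simp [connectedCount_of_not_even hn]

theorem constantCoeff_genZ_zero : constantCoeff (genZ 0) = 1 := by
  rw [← coeff_zero_eq_constantCoeff_apply, genZ, coeff_mk]
  simp

/-- The generating function of the ribbon graphs all of whose components carry a leg: the division
by `𝒵₀` removes the components without legs. -/
noncomputable def leggedEgf : ℚ⟦X⟧⟦X⟧ :=
  C (genZ 0)⁻¹ * egf count

theorem coeff_leggedEgf (N : ℕ) :
    coeff N leggedEgf = (genZ 0)⁻¹ * ((N ! : ℚ) ^ 2)⁻¹ • genZ N := by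
  rw [leggedEgf, coeff_C_mul, coeff_egf_count]

theorem constantCoeff_leggedEgf : constantCoeff leggedEgf = 1 := by
  rw [← coeff_zero_eq_constantCoeff_apply, coeff_leggedEgf, Nat.factorial_zero,
    Nat.cast_one, one_pow, inv_one, one_smul,
    PowerSeries.inv_mul_cancel _ (by simp [constantCoeff_genZ_zero])]

theorem inv_factorial_smul_genNRootedMaps_eq_coeff_logOf {N : ℕ} (hN : N ≠ 0) :
    (N ! : ℚ)⁻¹ • genNRootedMaps N = coeff N (logOf leggedEgf) := by
  rw [← coeff_egf_connectedCount hN]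
  refine coeff_eq_coeff_logOf constantCoeff_leggedEgf ?_ hN
  rw [leggedEgf, derivative_C_mul, derivative_egf_eq_mul count_succ]
  ring

theorem genNRootedMaps_eq_closedForm {N : ℕ} (hN : N ≠ 0) : genNRootedMaps N = closedForm N := by
  have hinv (s : ℕ) : (genZ 0 ^ s)⁻¹ = (genZ 0)⁻¹ ^ s := by
    rw [inv_eq_iff_mul_eq_one (by simp [constantCoeff_genZ_zero]), ← mul_pow,
      PowerSeries.inv_mul_cancel _ (by simp [constantCoeff_genZ_zero]), one_pow]
  have hlog := inv_factorial_smul_genNRootedMaps_eq_coeff_logOf hN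
  rw [inv_smul_eq_iff₀ (by positivity),
    coeff_logOf_eq_sum_partitionTuples constantCoeff_leggedEgf hN,
    smul_sum] at hlog
  rw [hlog, closedForm]
  refine sum_congr rfl fun a _ => ?_
  simp only [coeff_leggedEgf, mul_pow, prod_mul_distrib, prod_pow_eq_pow_sum, hinv, smul_smul]
  congr 1
  ring

end GeneratingFunctions

theorem theorem2 (N : ℕ) (hN : 1 ≤ N) :
    genNRootedMaps N = closedForm N ∧
    (∀ e : ℕ, (numNRootedMaps N e : ℚ) = PowerSeries.coeff (2 * e) (closedForm N)) ∧
    (∀ e : ℕ, (numNRootedMaps N e : ℚ) =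
      1 / ((2 * e)! : ℚ) *
        PowerSeries.constantCoeff ((⇑(PowerSeries.derivative ℚ))^[2 * e] (genNRootedMaps N))) := by
  have hclosed : genNRootedMaps N = closedForm N :=
    genNRootedMaps_eq_closedForm (Nat.one_le_iff_ne_zero.1 hN)
  have hcoeff (e : ℕ) :
      (numNRootedMaps N e : ℚ) = PowerSeries.coeff (2 * e) (genNRootedMaps N) := by
    rw [genNRootedMaps, PowerSeries.coeff_mk, if_pos (even_two_mul e),
      Nat.mul_div_cancel_left _ two_pos]
  refine ⟨hclosed, fun e => hclosed ▸ hcoeff e, fun e => ?_⟩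
  rw [PowerSeries.constantCoeff_iterate_derivative, hcoeff, one_div,
    inv_mul_cancel_left₀ (by positivity)]
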